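/- Let $k$ be an algebraically closed field of arbitrary characteristic, let $\ell$ be a prime number, let $n\ge 0$, and let $G$ be an $\ell$-Sylow subgroup of the symmetric group $\mathfrak S_n$. Let $V$ be a finite-dimensional faithful representation of $G$ over $k$. Then the quotient variety $G\backslash V=\operatorname{Spec} k[V]^G$, where $k[V]=\operatorname{Sym}(V^*)$ is the ring of polynomial functions on $V$, is stably rational over $k$; that is, there exist integers $r,m\ge 0$ such that $(G\backslash V)\times\mathbb A^r_k$ is birational over $k$ to $\mathbb A^m_k$. -/

import Mathlib

open AlgebraicGeometry CategoryTheory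

universe u

noncomputable section

/-- An `S`-scheme `X` is stably rational over `S` if, for some natural numbers `n` and `m`,
the product `X × 𝔸ⁿ` is birational over `S` to the affine space `𝔸ᵐ`; in other words,
`X` is stably birational to `S` over `S`. -/
def AlgebraicGeometry.Scheme.IsStablyRationalOver {X S : Scheme.{u}} (sX : X ⟶ S) : Prop :=
  ∃ n m : ℕ, Scheme.BirationalOver
    ((𝔸(ULift.{u} (Fin n); X) ↘ X) ≫ sX) (𝔸(ULift.{u} (Fin m); S) ↘ S)

namespace Representation

variable {k G V : Type*} [Field k] [Group G] [AddCommGroup V] [Module k V]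

/-- The action of `g` on the coordinate ring `k[V] = Sym(V*)` of a representation `V`,
by `(g • f)(v) = f(g⁻¹ v)`: the algebra map extending the dual representation on `V*`. -/
def coordinateMap (ρ : Representation k G V) (g : G) :
    SymmetricAlgebra k (Module.Dual k V) →ₐ[k] SymmetricAlgebra k (Module.Dual k V) :=
  SymmetricAlgebra.lift (SymmetricAlgebra.ι k (Module.Dual k V) ∘ₗ ρ.dual g)

/-- The ring of invariants `k[V]^G`. -/
def invariantRing (ρ : Representation k G V) :
    Subalgebra k (SymmetricAlgebra k (Module.Dual k V)) where
  carrier := {f | ∀ g : G, ρ.coordinateMap g f = f}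
  mul_mem' ha hb g := by rw [map_mul, ha g, hb g]
  add_mem' ha hb g := by rw [map_add, ha g, hb g]
  algebraMap_mem' r g := AlgHom.commutes _ r

end Representation

section

variable {k V : Type u} {G : Type*} [Field k] [Group G] [AddCommGroup V] [Module k V]

/-- The quotient variety `G\V = Spec k[V]^G` of the affine space of a representation `V`. -/
def Representation.quotientVariety (ρ : Representation k G V) : Scheme.{u} :=
  Spec (CommRingCat.of ρ.invariantRing)

/-- The structure morphism `G\V ⟶ Spec k`. -/
def Representation.quotientVarietyHom (ρ : Representation k G V) :
    ρ.quotientVariety ⟶ Spec (CommRingCat.of k) :=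
  Spec.map (CommRingCat.ofHom (algebraMap k ρ.invariantRing))

end

end

/-! The invariant ring is a finitely generated domain with fraction field `k(V)^G`, and finitely
generated domains over `k` with the same fraction field have birational spectra. It therefore
suffices that `k(V)^G` is a stably rational field.

The no-name lemma makes the choice of representation irrelevant. If a finite group acts faithfully
on `F`, and on `F(w)` by affine transformations of the independent generators `w`, Galois descent
replaces `w` by invariant generators, so `F(w)^G` is rational over `F^G`. Two faithful affine
actions, on `k(y)` and on `k(Z)`, can both be compared with the joint field `k(y, Z)`, so their
invariant fields are stably rational simultaneously (`isStablyRationalField_fixed_iff`).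

A convenient model then allows induction on `n`. The group `G` is a wreath product of `ℤ/ℓ` with a
Sylow subgroup `P` of the symmetric group on `n / ℓ` letters. Since `ℤ/ℓ` acts faithfully on the
affine line, with a monic invariant `N` of degree `ℓ`, the wreath product acts on `k(Z_i)`, `i < n /
ℓ`. The invariants of its base group are `k(N(Z_i))`, where `P` permutes the generators, so `k(Z)^G`
is isomorphic to `k(Y)^P` for a permutation action (`nonempty_fixed_algEquiv_fixed`). Affine rather
than linear actions are needed to include characteristic `ℓ`, where `ℤ/ℓ` acts by translations. -/

/-- A field extension `E / F` is rational if it is generated by finitely many algebraically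
independent elements. -/
def IsRationalExtension (F E : Type*) [Field F] [Field E] [Algebra F E] : Prop :=
  ∃ (d : ℕ) (t : Fin d → E), AlgebraicIndependent F t ∧
    IntermediateField.adjoin F (Set.range t) = ⊤

/-- A field `E` over `k` is stably rational if some rational extension of `E` is rational
over `k`. -/
def IsStablyRationalField (k E : Type u) [Field k] [Field E] [Algebra k E] : Prop :=
  ∃ (L : Type u) (_ : Field L) (_ : Algebra k L) (_ : Algebra E L) (_ : IsScalarTower k E L),
    IsRationalExtension E L ∧ IsRationalExtension k L

/-! ### Rational extensions of fields -/

section RationalExtension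

variable {F E L : Type*} [Field F] [Field E] [Field L] [Algebra F E] [Algebra F L] [Algebra E L]
  [IsScalarTower F E L]

lemma IsRationalExtension.of_finite {ι : Type*} [Finite ι] {t : ι → E}
    (ht : AlgebraicIndependent F t) (ht' : IntermediateField.adjoin F (Set.range t) = ⊤) :
    IsRationalExtension F E := by
  obtain ⟨d, ⟨e⟩⟩ := Finite.exists_equiv_fin ι
  refine ⟨d, t ∘ e.symm, ht.comp _ e.symm.injective, ?_⟩
  rwa [e.symm.surjective.range_comp]

lemma IsRationalExtension.of_surjective (h : Function.Surjective (algebraMap F E)) :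
    IsRationalExtension F E := by
  refine ⟨0, Fin.elim0, algebraicIndependent_empty_type_iff.2 (algebraMap F E).injective, ?_⟩
  rw [eq_top_iff]
  rintro x -
  obtain ⟨y, rfl⟩ := h x
  exact IntermediateField.algebraMap_mem _ y

/-- If `E` is generated by `s` over `F`, then a subfield of `L` containing `F` and the image of
`s` contains the image of `E`. -/
lemma IntermediateField.algebraMap_mem_of_adjoin_eq_top {s : Set E}
    (hs : IntermediateField.adjoin F s = ⊤) (M : IntermediateField F L)
    (h : ∀ x ∈ s, algebraMap E L x ∈ M) (x : E) : algebraMap E L x ∈ M := by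
  have : IntermediateField.adjoin F s ≤ M.comap (IsScalarTower.toAlgHom F E L) :=
    IntermediateField.adjoin_le_iff.2 h
  rw [hs] at this
  exact this (x := x) trivial

lemma IntermediateField.adjoin_union_eq_top {s : Set E} {t : Set L}
    (hs : IntermediateField.adjoin F s = ⊤) (ht : IntermediateField.adjoin E t = ⊤) :
    IntermediateField.adjoin F (t ∪ algebraMap E L '' s) = ⊤ := by
  set M := IntermediateField.adjoin F (t ∪ algebraMap E L '' s)
  have hE : ∀ x, algebraMap E L x ∈ M :=
    IntermediateField.algebraMap_mem_of_adjoin_eq_top hs M fun x hx ↦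
      IntermediateField.subset_adjoin _ _ (.inr ⟨x, hx, rfl⟩)
  let M' : IntermediateField E L := { M with algebraMap_mem' := hE }
  have : IntermediateField.adjoin E t ≤ M' :=
    IntermediateField.adjoin_le_iff.2 fun x hx ↦ IntermediateField.subset_adjoin F _ (.inl hx)
  rw [ht] at this
  exact eq_top_iff.2 fun x _ ↦ this (x := x) trivial

lemma IsRationalExtension.trans (h : IsRationalExtension F E) (h' : IsRationalExtension E L) :
    IsRationalExtension F L := by
  obtain ⟨d, t, ht, ht'⟩ := h
  obtain ⟨e, s, hs, hs'⟩ := h'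
  refine .of_finite (ht.sumElim_comp hs) ?_
  rw [Set.Sum.elim_range, Set.range_comp]
  exact IntermediateField.adjoin_union_eq_top ht' hs'

lemma IsFractionRing.adjoin_eq_top_of_mvPolynomial {ι : Type*} [Algebra (MvPolynomial ι F) E]
    [IsScalarTower F (MvPolynomial ι F) E] [IsFractionRing (MvPolynomial ι F) E] :
    IntermediateField.adjoin F
      (Set.range fun i : ι ↦ algebraMap (MvPolynomial ι F) E (.X i)) = ⊤ := by
  set N := IntermediateField.adjoin F
    (Set.range fun i : ι ↦ algebraMap (MvPolynomial ι F) E (.X i))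
  have h (p : MvPolynomial ι F) : algebraMap (MvPolynomial ι F) E p ∈ N := by
    induction p using MvPolynomial.induction_on with
    | C a =>
      rw [← MvPolynomial.algebraMap_eq, ← IsScalarTower.algebraMap_apply]
      exact N.algebraMap_mem a
    | add p q hp hq => rw [map_add]; exact N.add_mem hp hq
    | mul_X p i hp =>
      rw [map_mul]
      exact N.mul_mem hp (IntermediateField.subset_adjoin _ _ ⟨i, rfl⟩)
  rw [eq_top_iff]
  rintro x -
  obtain ⟨p, q, -, rfl⟩ := IsFractionRing.div_surjective (MvPolynomial ι F) x
  exact N.div_mem (h p) (h q)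

lemma IsFractionRing.algebraicIndependent_of_mvPolynomial {ι : Type*}
    [Algebra (MvPolynomial ι F) E]
    [IsScalarTower F (MvPolynomial ι F) E] [IsFractionRing (MvPolynomial ι F) E] :
    AlgebraicIndependent F (fun i : ι ↦ algebraMap (MvPolynomial ι F) E (.X i)) :=
  (MvPolynomial.algebraicIndependent_X ι F).map'
    (f := IsScalarTower.toAlgHom F (MvPolynomial ι F) E) (IsFractionRing.injective _ _)

/-- Rational function fields exist. -/
lemma exists_rationalFunctionField (ι : Type) (F : Type u) [Field F] :
    ∃ (E : Type u) (_ : Field E) (_ : Algebra F E) (X : ι → E), AlgebraicIndependent F X ∧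
      IntermediateField.adjoin F (Set.range X) = ⊤ :=
  ⟨FractionRing (MvPolynomial ι F), inferInstance, inferInstance, _,
    IsFractionRing.algebraicIndependent_of_mvPolynomial,
    IsFractionRing.adjoin_eq_top_of_mvPolynomial⟩

end RationalExtension

section Lift

variable {F E L : Type*} [Field F] [Field E] [Field L] [Algebra F E] [Algebra F L]

/-- A map out of a rational extension can be prescribed on algebraically independent generators,
provided that their images are algebraically independent. -/
lemma AlgebraicIndependent.exists_algHom {ι : Type*} {t : ι → E} {s : ι → L}
    (ht : AlgebraicIndependent F t) (ht' : IntermediateField.adjoin F (Set.range t) = ⊤)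
    (hs : AlgebraicIndependent F s) : ∃ f : E →ₐ[F] L, ∀ i, f (t i) = s i := by
  let e := (ht.aevalEquivField.trans (IntermediateField.equivOfEq ht')).trans
    IntermediateField.topEquiv
  have he (i : ι) : e (algebraMap (MvPolynomial ι F) _ (MvPolynomial.X i)) = t i := by
    change (ht.aevalEquivField (algebraMap (MvPolynomial ι F) _ (MvPolynomial.X i)) : E) = t i
    simp
  refine ⟨((IntermediateField.val _).comp hs.aevalEquivField.toAlgHom).comp e.symm.toAlgHom,
    fun i ↦ ?_⟩
  rw [← he]
  simp

end Lift

section Swap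

variable {E A B M : Type*} [Field E] [Field A] [Field B] [Field M] [Algebra E A] [Algebra E B]
  [Algebra A M] [Algebra B M] [Algebra E M] [IsScalarTower E A M] [IsScalarTower E B M]
  {ι ι' : Type*} {x : ι → A} {y : ι' → B}

/-- Joint independence of `y` and `x` over `E` is symmetric, and `A` is `E(x)`. Together with
`IntermediateField.adjoin_swap`, this lets one field `M` be read both as `B(x)` and as `A(y)`. -/
lemma AlgebraicIndependent.swap (hx : IntermediateField.adjoin E (Set.range x) = ⊤)
    (hy : AlgebraicIndependent E y) (hxM : AlgebraicIndependent B (algebraMap A M ∘ x)) :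
    AlgebraicIndependent A (algebraMap B M ∘ y) := by
  have h1 := hy.sumElim_comp hxM
  have h2 : AlgebraicIndependent E (Sum.elim (algebraMap B M ∘ y) (algebraMap A M ∘ x)) :=
    (algebraicIndependent_equiv' (Equiv.sumComm _ _) (by ext (_ | _) <;> rfl)).1 h1
  have h3 := IntermediateField.algebraicIndependent_adjoin_iff.2
    (AlgebraicIndependent.sumElim_iff.1 h2).2
  let f : A →+* IntermediateField.adjoin E (Set.range (algebraMap A M ∘ x)) :=
    (algebraMap A M).codRestrict _ (IntermediateField.algebraMap_mem_of_adjoin_eq_top hx _ (by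
      rintro _ ⟨i, rfl⟩
      exact IntermediateField.subset_adjoin _ _ ⟨i, rfl⟩))
  exact h3.of_ringHom_of_comp_eq f (RingHom.id M) f.injective (by ext; rfl)

lemma IntermediateField.adjoin_swap (hy : IntermediateField.adjoin E (Set.range y) = ⊤)
    (hxM : IntermediateField.adjoin B (Set.range (algebraMap A M ∘ x)) = ⊤) :
    IntermediateField.adjoin A (Set.range (algebraMap B M ∘ y)) = ⊤ := by
  set N := IntermediateField.adjoin A (Set.range (algebraMap B M ∘ y))
  have h := IntermediateField.adjoin_union_eq_top hy hxM
  have : IntermediateField.adjoin E (Set.range (algebraMap A M ∘ x) ∪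
      algebraMap B M '' Set.range y) ≤ N.restrictScalars E := by
    refine IntermediateField.adjoin_le_iff.2 ?_
    rintro _ (⟨i, rfl⟩ | ⟨_, ⟨i, rfl⟩, rfl⟩)
    · exact (IntermediateField.mem_restrictScalars E).2 (N.algebraMap_mem _)
    · exact (IntermediateField.mem_restrictScalars E).2
        (IntermediateField.subset_adjoin _ _ ⟨i, rfl⟩)
  rw [h] at this
  exact eq_top_iff.2 fun x _ ↦ (IntermediateField.mem_restrictScalars E).1
    (this IntermediateField.mem_top)

end Swap

/-! ### Stably rational fields -/

section StablyRational

variable {k E L : Type u} [Field k] [Field E] [Field L] [Algebra k E] [Algebra k L] [Algebra E L]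
  [IsScalarTower k E L]

lemma IsRationalExtension.isStablyRationalField (h : IsRationalExtension k E) :
    IsStablyRationalField k E :=
  ⟨E, _, _, _, inferInstance, .of_surjective Function.surjective_id, h⟩

lemma IsStablyRationalField.of_isRationalExtension (h : IsRationalExtension E L)
    (hL : IsStablyRationalField k L) : IsStablyRationalField k E := by
  obtain ⟨L', _, _, _, _, h1, h2⟩ := hL
  let _ : Algebra E L' := ((algebraMap L L').comp (algebraMap E L)).toAlgebra
  have : IsScalarTower E L L' := .of_algebraMap_eq fun _ ↦ rfl
  have : IsScalarTower k E L' := .of_algebraMap_eq fun x ↦ by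
    rw [IsScalarTower.algebraMap_apply k L L', IsScalarTower.algebraMap_apply k E L]
    rfl
  exact ⟨L', _, _, _, inferInstance, h.trans h1, h2⟩

/-- If `L = E(t)` and `L' = E(s)` is rational over `k`, then `E(s, t)` is rational over both `L` and
`k`. -/
lemma IsStablyRationalField.isRationalExtension_trans (h : IsRationalExtension E L)
    (hE : IsStablyRationalField k E) : IsStablyRationalField k L := by
  obtain ⟨d, t, ht, ht'⟩ := h
  obtain ⟨L', _, _, _, _, ⟨e, s, hs, hs'⟩, h2⟩ := hE
  obtain ⟨M, _, _, X, hX, hX'⟩ := exists_rationalFunctionField (Fin d) L'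
  let _ : Algebra E M := ((algebraMap L' M).comp (algebraMap E L')).toAlgebra
  have : IsScalarTower E L' M := .of_algebraMap_eq fun _ ↦ rfl
  let _ : Algebra k M := ((algebraMap L' M).comp (algebraMap k L')).toAlgebra
  have : IsScalarTower k L' M := .of_algebraMap_eq fun _ ↦ rfl
  have : IsScalarTower k E M := .of_algebraMap_eq fun x ↦ by
    rw [IsScalarTower.algebraMap_apply k L' M, IsScalarTower.algebraMap_apply k E L',
      ← IsScalarTower.algebraMap_apply E L' M]
  obtain ⟨f, hf⟩ := ht.exists_algHom ht' (hX.restrictScalars (algebraMap E L').injective)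
  let _ : Algebra L M := f.toRingHom.toAlgebra
  have : IsScalarTower E L M := .of_algebraMap_eq fun x ↦ (f.commutes x).symm
  have : IsScalarTower k L M := .of_algebraMap_eq fun x ↦ by
    rw [IsScalarTower.algebraMap_apply k E L, ← IsScalarTower.algebraMap_apply E L M,
      ← IsScalarTower.algebraMap_apply k E M]
  obtain rfl : algebraMap L M ∘ t = X := funext hf
  refine ⟨M, _, _, _, inferInstance,
    ⟨e, algebraMap L' M ∘ s, .swap (E := E) ht' hs hX, IntermediateField.adjoin_swap hs' hX'⟩,
    h2.trans ⟨d, _, hX, hX'⟩⟩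

end StablyRational

lemma IsStablyRationalField.of_algEquiv {k E L : Type u} [Field k] [Field E] [Field L]
    [Algebra k E] [Algebra k L] (e : E ≃ₐ[k] L) (hL : IsStablyRationalField k L) :
    IsStablyRationalField k E := by
  let _ : Algebra E L := e.toRingHom.toAlgebra
  have : IsScalarTower k E L := .of_algebraMap_eq fun x ↦ (e.commutes x).symm
  exact .of_isRationalExtension (.of_surjective e.surjective) hL

/-! ### Galois descent and the no-name lemma -/

section NoName

variable {F L : Type*} [Field F] [Field L] [Algebra F L] (G : Type*) [Group G] [Finite G]
  [MulSemiringAction G F] [MulSemiringAction G L] [SMulDistribClass G F L] [FaithfulSMul G F]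

/-- Galois descent: a subspace stable under a semilinear action of a finite group acting
faithfully on the field of scalars is spanned by fixed vectors. -/
lemma Submodule.le_span_fixed (M : Submodule F L) (hM : ∀ g : G, ∀ v ∈ M, g • v ∈ M) :
    M ≤ Submodule.span F {v | v ∈ M ∧ ∀ g : G, g • v = v} := by
  have := Fintype.ofFinite G
  set N := Submodule.span F {v | v ∈ M ∧ ∀ g : G, g • v = v}
  intro v hv
  by_contra hvN
  obtain ⟨φ, hφ, hN⟩ := Submodule.exists_le_ker_of_notMem hvN
  -- The trace of `a • v` is a fixed vector of `M`, so `φ` kills it. As `a` varies this is a linear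
  -- relation among the characters `a ↦ g • a`, distinct by faithfulness; Dedekind's theorem forces
  -- `φ v = 0`.
  have hsum (a : F) : ∑ g : G, φ (g • v) * (g • a) = 0 := by
    have : ∑ g : G, g • (a • v) ∈ N := by
      refine Submodule.subset_span ⟨M.sum_mem fun g _ ↦ hM g _ (M.smul_mem a hv), fun h ↦ ?_⟩
      rw [Finset.smul_sum]
      simp_rw [← mul_smul]
      exact Fintype.sum_equiv (Equiv.mulLeft h) _ _ fun g ↦ rfl
    have := hN this
    rw [LinearMap.mem_ker, map_sum] at this
    rw [← this]
    refine Finset.sum_congr rfl fun g _ ↦ ?_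
    rw [smul_distrib_smul, LinearMap.map_smul, smul_eq_mul, mul_comm]
  let χ : G → (F →* F) := fun g ↦ (MulSemiringAction.toRingHom G F g : F →* F)
  have hχ : Function.Injective χ := fun g h hgh ↦
    eq_of_smul_eq_smul fun a : F ↦ DFunLike.congr_fun hgh a
  have hli := (linearIndependent_monoidHom F F).comp χ hχ
  have := Fintype.linearIndependent_iff.1 hli (fun g ↦ φ (g • v)) (by
    ext a
    simpa [χ, Finset.sum_apply] using hsum a) 1
  rw [one_smul] at this
  exact hφ this

/-- The no-name lemma for affine actions: generators on which a group acts through affine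
transformations can be replaced by invariant ones. -/
lemma exists_fixed_generators {ι : Type*} [Finite ι] {w : ι → L} (hw : AlgebraicIndependent F w)
    (hw' : IntermediateField.adjoin F (Set.range w) = ⊤)
    (hG : ∀ (g : G) i, g • w i ∈ Submodule.span F (insert 1 (Set.range w))) :
    ∃ (d : ℕ) (t : Fin d → L), (∀ (g : G) i, g • t i = t i) ∧ AlgebraicIndependent F t ∧
      IntermediateField.adjoin F (Set.range t) = ⊤ := by
  set M := Submodule.span F (insert 1 (Set.range w))
  have hM (g : G) (v : L) (hv : v ∈ M) : g • v ∈ M := by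
    induction hv using Submodule.span_induction with
    | mem x hx =>
      obtain rfl | ⟨i, rfl⟩ := hx
      · rw [smul_one]
        exact Submodule.subset_span (.inl rfl)
      · exact hG g i
    | zero => rw [smul_zero]; exact M.zero_mem
    | add x y _ _ hx hy => rw [smul_add]; exact M.add_mem hx hy
    | smul a x _ hx => rw [smul_distrib_smul]; exact M.smul_mem _ hx
  set S := {v | v ∈ M ∧ ∀ g : G, g • v = v}
  have h1S : {(1 : L)} ⊆ S :=
    Set.singleton_subset_iff.2 ⟨Submodule.subset_span (.inl rfl), fun g ↦ smul_one g⟩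
  -- The basis of fixed vectors is made to contain `1`, which is then discarded: at most `Nat.card
  -- ι` generators remain.
  obtain ⟨b, hbS, h1b, hSb, hb⟩ := exists_linearIndepOn_id_extension
    (K := F) (s := {(1 : L)}) (t := S) (LinearIndepOn.singleton one_ne_zero) h1S
  have hbcard : Cardinal.mk b ≤ (Nat.card ι + 1 : ℕ) := by
    have hfin : (insert 1 (Set.range w)).Finite := (Set.finite_range w).insert 1
    have := hfin.fintype
    refine (linearIndependent_le_span' _ hb (insert 1 (Set.range w)) ?_).trans ?_
    · rintro _ ⟨x, rfl⟩
      exact (hbS x.2).1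
    · rw [← Nat.card_eq_fintype_card, Nat.cast_le]
      exact (Set.ncard_insert_le _ _).trans (Nat.add_le_add_right (Finite.card_range_le w) 1)
  have hbfin : b.Finite := Cardinal.lt_aleph0_iff_set_finite.1
    (hbcard.trans_lt Cardinal.natCast_lt_aleph0)
  have hTcard : Nat.card (b \ {1} : Set L) ≤ Nat.card ι := by
    have h1 : b.ncard ≤ Nat.card ι + 1 := by
      have := hbfin.to_subtype
      rwa [← Nat.cast_card, Nat.cast_le] at hbcard
    have h2 := Set.ncard_sdiff_singleton_add_one (Set.singleton_subset_iff.1 h1b) hbfin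
    exact Nat.le_of_succ_le_succ (h2.trans_le h1)
  have : Finite (b \ {1} : Set L) := (hbfin.subset Set.sdiff_subset).to_subtype
  have hgen : IntermediateField.adjoin F (Set.range ((↑) : (b \ {1} : Set L) → L)) = ⊤ := by
    rw [Subtype.range_coe, eq_top_iff, ← hw']
    set A := IntermediateField.adjoin F (b \ {1})
    have hspan : Submodule.span F b ≤ A.toSubalgebra.toSubmodule := by
      refine Submodule.span_le.2 fun x hx ↦ ?_
      by_cases hx1 : x = 1
      · exact hx1 ▸ A.one_mem
      · exact IntermediateField.subset_adjoin _ _ ⟨hx, hx1⟩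
    refine IntermediateField.adjoin_le_iff.2 ?_
    rintro _ ⟨i, rfl⟩
    refine hspan (Submodule.span_le.2 hSb (M.le_span_fixed G hM ?_))
    exact Submodule.subset_span (.inr ⟨i, rfl⟩)
  have halg : Algebra.IsAlgebraic
      (Algebra.adjoin F (Set.range ((↑) : (b \ {1} : Set L) → L))) L := by
    rw [← IntermediateField.isAlgebraic_adjoin_iff_top, hgen]
    exact ⟨fun x ↦ isAlgebraic_algebraMap (⟨x, trivial⟩ : (⊤ : IntermediateField F L))⟩
  -- A generating set no larger than the transcendence degree is algebraically independent.
  have htb := Algebra.IsAlgebraic.isTranscendenceBasis_of_lift_le_trdeg_of_finite F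
    ((↑) : (b \ {1} : Set L) → L) (by
      have h := hw.lift_cardinalMk_le_trdeg
      rw [← Nat.cast_card, Cardinal.lift_natCast, Cardinal.nat_le_lift_iff] at h
      rw [← Nat.cast_card, Cardinal.lift_natCast, Cardinal.nat_le_lift_iff]
      exact (Nat.cast_le.2 hTcard).trans h)
  obtain ⟨d, ⟨e⟩⟩ := Finite.exists_equiv_fin (b \ {1} : Set L)
  refine ⟨d, (↑) ∘ e.symm, fun g i ↦ (hbS (e.symm i).2.1).2 g,
    htb.1.comp _ e.symm.injective, ?_⟩
  rwa [e.symm.surjective.range_comp]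

end NoName

section FixedField

variable {k F L : Type u} [Field k] [Field F] [Field L] [Algebra k F] [Algebra k L] [Algebra F L]
  [IsScalarTower k F L] {G : Type*} [Group G] [Finite G]
  [MulSemiringAction G F] [MulSemiringAction G L] [SMulDistribClass G F L] [FaithfulSMul G F]
  [SMulCommClass G k F] [SMulCommClass G k L]

/-- A field acted on faithfully by a finite group, and an extension with affine action: the
invariant fields are stably rational simultaneously. -/
lemma isStablyRationalField_fixed_iff {ι : Type*} [Finite ι] {w : ι → L}
    (hw : AlgebraicIndependent F w) (hw' : IntermediateField.adjoin F (Set.range w) = ⊤)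
    (hG : ∀ (g : G) i, g • w i ∈ Submodule.span F (insert 1 (Set.range w))) :
    IsStablyRationalField k (FixedPoints.intermediateField (F := k) (E := F) G) ↔
      IsStablyRationalField k (FixedPoints.intermediateField (F := k) (E := L) G) := by
  have := Fintype.ofFinite G
  obtain ⟨d, t, htG, ht, ht'⟩ := exists_fixed_generators G hw hw' hG
  set K₀ := FixedPoints.intermediateField (F := k) (E := F) G
  set L₀ := FixedPoints.intermediateField (F := k) (E := L) G
  have hsmul (g : G) (a : F) : g • algebraMap F L a = algebraMap F L (g • a) := by
    rw [Algebra.algebraMap_eq_smul_one, smul_distrib_smul, smul_one, Algebra.algebraMap_eq_smul_one]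
  let i : K₀ →+* L₀ := ((algebraMap F L).comp (algebraMap K₀ F)).codRestrict L₀ fun x g ↦ by
    rw [RingHom.comp_apply, hsmul]
    exact congrArg _ (x.2 g)
  let _ : Algebra K₀ L₀ := i.toAlgebra
  have : IsScalarTower k K₀ L₀ := .of_algebraMap_eq fun x ↦
    Subtype.ext (IsScalarTower.algebraMap_apply k F L x)
  have : IsScalarTower K₀ L₀ L := .of_algebraMap_eq fun x ↦ rfl
  have hSMC : SMulCommClass G K₀ L := ⟨fun g a x ↦ by
    rw [Algebra.smul_def, Algebra.smul_def, smul_mul']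
    congr 1
    exact (i a).2 g⟩
  have hFaithful : FaithfulSMul G L := ⟨fun {g h} hgh ↦ eq_of_smul_eq_smul fun a : F ↦
    (algebraMap F L).injective (by rw [← hsmul, ← hsmul, hgh])⟩
  -- Degrees show that `K₀(t)` is all of `L^G`: it is contained in it, `L` has degree `#G` over
  -- `L^G`, and `L` is generated over `K₀(t)` by `F`, of degree `#G` over `K₀`.
  let A := IntermediateField.adjoin K₀ (Set.range t)
  let E := FixedPoints.intermediateField (F := K₀) (E := L) G
  have hAE : A ≤ E := IntermediateField.adjoin_le_iff.2 (by
    rintro _ ⟨j, rfl⟩ g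
    exact htG g j)
  have hE : Module.finrank E L = Fintype.card G := FixedPoints.finrank_eq_card G L
  have hK₀ : Module.rank K₀ F = Fintype.card G := by
    have : Module.finrank K₀ F = Fintype.card G := FixedPoints.finrank_eq_card G F
    have hfd : FiniteDimensional K₀ F :=
      inferInstanceAs (FiniteDimensional (FixedPoints.subfield G F) F)
    rw [← Module.finrank_eq_rank, this]
  have hfd : FiniteDimensional K₀ F := Module.rank_lt_aleph0_iff.1 (by rw [hK₀]; simp)
  have hA : Module.rank A L ≤ Fintype.card G := by
    let R := (IsScalarTower.toAlgHom K₀ F L).fieldRange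
    let e : F ≃ₗ[K₀] R := (AlgEquiv.ofInjectiveField (IsScalarTower.toAlgHom K₀ F L)).toLinearEquiv
    have : FiniteDimensional K₀ R := e.finiteDimensional
    have htop : IntermediateField.adjoin A (R : Set L) = ⊤ := by
      set B := IntermediateField.adjoin A (R : Set L)
      let B' : IntermediateField F L := { B with
        algebraMap_mem' := fun x ↦ IntermediateField.subset_adjoin A _ ⟨x, rfl⟩ }
      have hB' : IntermediateField.adjoin F (Set.range t) ≤ B' :=
        IntermediateField.adjoin_le_iff.2 fun x hx ↦
          B.algebraMap_mem ⟨x, IntermediateField.subset_adjoin K₀ _ hx⟩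
      rw [ht'] at hB'
      exact eq_top_iff.2 fun x _ ↦ hB' (x := x) trivial
    have := IntermediateField.adjoin_rank_le_of_isAlgebraic_right A R
    rwa [htop, IntermediateField.topEquiv.toLinearEquiv.rank_eq, ← e.rank_eq, hK₀] at this
  have hAE' : A = E := by
    have : FiniteDimensional A L :=
       Module.rank_lt_aleph0_iff.1 (hA.trans_lt Cardinal.natCast_lt_aleph0)
    exact IntermediateField.eq_of_le_of_finrank_le' hAE
      (hE ▸ Module.finrank_le_of_rank_le hA)
  have hrat : IsRationalExtension K₀ L₀ := by
    let t' : Fin d → L₀ := fun j ↦ ⟨t j, fun g ↦ htG g j⟩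
    refine ⟨d, t', .of_comp (IsScalarTower.toAlgHom K₀ L₀ L)
      (ht.restrictScalars (K := F) (algebraMap K₀ F).injective), ?_⟩
    have hmap : (IntermediateField.adjoin K₀ (Set.range t')).map (IsScalarTower.toAlgHom K₀ L₀ L) =
        A := by
      rw [IntermediateField.adjoin_map, ← Set.range_comp]
      rfl
    rw [eq_top_iff]
    rintro x -
    have hx : (x : L) ∈ A := hAE' ▸ x.2
    rw [← hmap] at hx
    obtain ⟨y, hy, hyx⟩ := hx
    rwa [← Subtype.ext (a1 := y) (a2 := x) hyx]
  exact ⟨fun h ↦ h.isRationalExtension_trans hrat, .of_isRationalExtension hrat⟩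

end FixedField

/-! ### Construction of monomial affine actions -/

section MonomialAffine

/-- Given a field `K` with an action of `G`, a permutation action of `G` on `ι` and a compatible
system of affine transformations, the action extends to the rational function field
`K(Xᵢ, i ∈ ι)`. -/
lemma exists_monomialAffine_extension {k K : Type u} [Field k] [Field K] [Algebra k K]
    {G : Type*} [Group G] [MulSemiringAction G K] [SMulCommClass G k K] {ι : Type}
    (π : G →* Equiv.Perm ι) (α β : G → ι → k) (hα₁ : ∀ i, α 1 i = 1) (hβ₁ : ∀ i, β 1 i = 0)
    (hα : ∀ g h i, α (g * h) i = α h i * α g (π h i))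
    (hβ : ∀ g h i, β (g * h) i = α h i * β g (π h i) + β h i) :
    ∃ (L : Type u) (_ : Field L) (_ : Algebra k L) (_ : Algebra K L) (_ : IsScalarTower k K L)
      (_ : MulSemiringAction G L) (_ : SMulDistribClass G K L) (_ : SMulCommClass G k L)
      (X : ι → L), AlgebraicIndependent K X ∧ IntermediateField.adjoin K (Set.range X) = ⊤ ∧
        ∀ g i, g • X i = algebraMap k L (α g i) * X (π g i) + algebraMap k L (β g i) := by
  have hk (g : G) (a : k) : g • algebraMap k K a = algebraMap k K a := smul_algebraMap g a
  let T (g : G) : MvPolynomial ι K →+* MvPolynomial ι K :=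
    MvPolynomial.eval₂Hom (MvPolynomial.C.comp (MulSemiringAction.toRingHom G K g))
      fun i ↦ .C (algebraMap k K (α g i)) * .X (π g i) + .C (algebraMap k K (β g i))
  have hTC (g : G) (a : K) : T g (.C a) = .C (g • a) := by simp [T]
  have hTX (g : G) (i : ι) : T g (.X i) =
      .C (algebraMap k K (α g i)) * .X (π g i) + .C (algebraMap k K (β g i)) := by simp [T]
  have hT₁ : T 1 = RingHom.id _ := by
    refine MvPolynomial.ringHom_ext (fun a ↦ ?_) fun a ↦ ?_
    · simp [hTC]
    · simp [hTX, hα₁, hβ₁]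
  have hTmul (g h : G) : T (g * h) = (T g).comp (T h) := by
    refine MvPolynomial.ringHom_ext (fun a ↦ ?_) fun a ↦ ?_
    · simp [hTC, mul_smul]
    · simp only [RingHom.comp_apply, hTX, map_add, map_mul, hTC, hk, hα, hβ, Equiv.Perm.mul_apply]
      ring
  let φ : G →* (MvPolynomial ι K ≃+* MvPolynomial ι K) :=
    { toFun := fun g ↦ RingEquiv.ofRingHom (T g) (T g⁻¹) (by rw [← hTmul, mul_inv_cancel, hT₁])
        (by rw [← hTmul, inv_mul_cancel, hT₁])
      map_one' := by ext1 x; exact DFunLike.congr_fun hT₁ x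
      map_mul' := fun g h ↦ by ext1 x; exact DFunLike.congr_fun (hTmul g h) x }
  let L := FractionRing (MvPolynomial ι K)
  let ψ : G →* (L ≃+* L) := (IsFractionRing.ringEquivOfRingEquivHom (MvPolynomial ι K) L).comp φ
  have hψ (g : G) (p : MvPolynomial ι K) :
      ψ g (algebraMap _ L p) = algebraMap _ L (T g p) :=
    IsFractionRing.ringEquivOfRingEquiv_algebraMap (φ g) p
  let _ : MulSemiringAction G L := MulSemiringAction.compHom L ψ
  have hK (a : K) : algebraMap K L a = algebraMap (MvPolynomial ι K) L (.C a) := rfl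
  have hgK (g : G) (a : K) : g • algebraMap K L a = algebraMap K L (g • a) := by
    rw [hK, hK, ← hTC]
    exact hψ g _
  have hD : SMulDistribClass G K L := ⟨fun g a x ↦ by
    rw [Algebra.smul_def, Algebra.smul_def, smul_mul', hgK]⟩
  have hC : SMulCommClass G k L := ⟨fun g a x ↦ by
    rw [← algebraMap_smul K a x, smul_distrib_smul, hk, algebraMap_smul]⟩
  refine ⟨L, inferInstance, inferInstance, inferInstance, inferInstance, inferInstance, hD, hC,
    fun i ↦ algebraMap (MvPolynomial ι K) L (.X i),
    IsFractionRing.algebraicIndependent_of_mvPolynomial,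
    IsFractionRing.adjoin_eq_top_of_mvPolynomial, fun g i ↦ ?_⟩
  refine (hψ g _).trans ?_
  rw [hTX, map_add, map_mul, ← hK, ← hK, ← IsScalarTower.algebraMap_apply,
    ← IsScalarTower.algebraMap_apply]

end MonomialAffine

section MonomialAffineField

lemma exists_monomialAffine_field (k : Type u) [Field k] {G : Type*} [Group G] {ι : Type}
    (π : G →* Equiv.Perm ι) (α β : G → ι → k) (hα₁ : ∀ i, α 1 i = 1) (hβ₁ : ∀ i, β 1 i = 0)
    (hα : ∀ g h i, α (g * h) i = α h i * α g (π h i))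
    (hβ : ∀ g h i, β (g * h) i = α h i * β g (π h i) + β h i)
    (hfaithful : ∀ g, (∀ i, π g i = i ∧ α g i = 1 ∧ β g i = 0) → g = 1) :
    ∃ (L : Type u) (_ : Field L) (_ : Algebra k L) (_ : MulSemiringAction G L)
      (_ : FaithfulSMul G L) (_ : SMulCommClass G k L)
      (X : ι → L), AlgebraicIndependent k X ∧ IntermediateField.adjoin k (Set.range X) = ⊤ ∧
        ∀ g i, g • X i = algebraMap k L (α g i) * X (π g i) + algebraMap k L (β g i) := by
  let _ : MulSemiringAction G k := MulSemiringAction.compHom k (1 : G →* (k ≃+* k))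
  have : SMulCommClass G k k := ⟨fun _ _ _ ↦ rfl⟩
  obtain ⟨L, _, i₁, i₂, ht, _, _, _, X, hX, hX', hG⟩ :=
    exists_monomialAffine_extension (K := k) π α β hα₁ hβ₁ hα hβ
  -- For `K = k` the field `L` carries two `k`-algebra structures, which the scalar tower
  -- identifies.
  obtain rfl : i₁ = i₂ := Algebra.algebra_ext _ _ fun r ↦
    @IsScalarTower.algebraMap_apply k k L _ _ _ (Algebra.id k) i₂ i₁ ht r
  have hf : FaithfulSMul G L := by
    refine ⟨fun {g h} hgh ↦ ?_⟩
    rw [← inv_mul_eq_one]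
    refine hfaithful _ fun i ↦ ?_
    have h1 : (g⁻¹ * h) • X i = X i := by rw [mul_smul, ← hgh, inv_smul_smul]
    rw [hG] at h1
    generalize g⁻¹ * h = a at *
    have h2 : (.C (α a i) * .X (π a i) + .C (β a i) : MvPolynomial ι k) = .X i :=
      algebraicIndependent_iff_injective_aeval.1 hX (by simpa using h1)
    have hβ : β a i = 0 := by
      simpa using congrArg MvPolynomial.constantCoeff h2
    have hπ : π a i = i := by
      classical
      by_contra hne
      have := congrArg (MvPolynomial.eval (Pi.single (M := fun _ ↦ k) i 1)) h2
      simp [hne, hβ] at this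
    refine ⟨hπ, ?_, hβ⟩
    have := congrArg (MvPolynomial.eval (fun _ ↦ (1 : k))) h2
    simpa [hβ] using this
  exact ⟨L, _, _, _, hf, inferInstance, X, hX, hX', hG⟩

end MonomialAffineField

/-! ### Invariants of the base group, by a degree count -/

section Degree

lemma AlgHom.ext_of_adjoin_range_eq_top {k E F ι : Type*} [Field k] [Field E] [Field F]
    [Algebra k E] [Algebra k F] {Y : ι → E} (hY : IntermediateField.adjoin k (Set.range Y) = ⊤)
    {f g : E →ₐ[k] F} (h : ∀ i, f (Y i) = g (Y i)) : f = g := by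
  let M : IntermediateField k E :=
    { AlgHom.equalizer f g with
      inv_mem' := fun x hx ↦ by
        change f x⁻¹ = g x⁻¹
        rw [map_inv₀, map_inv₀]
        exact congrArg _ hx }
  have hM : IntermediateField.adjoin k (Set.range Y) ≤ M :=
    IntermediateField.adjoin_le_iff.2 (by rintro _ ⟨i, rfl⟩; exact h i)
  rw [hY] at hM
  exact AlgHom.ext fun x ↦ hM (x := x) trivial

lemma IntermediateField.finrank_adjoin_image_le {K L : Type*} [Field K] [Field L] [Algebra K L]
    {ι : Type*} (x : ι → L) (d : ℕ) (hx : ∀ i, IsIntegral K (x i))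
    (hd : ∀ i, (minpoly K (x i)).natDegree ≤ d) (s : Finset ι) :
    FiniteDimensional K (IntermediateField.adjoin K (x '' s)) ∧
      Module.finrank K (IntermediateField.adjoin K (x '' s)) ≤ d ^ s.card := by
  classical
  induction s using Finset.induction_on with
  | empty =>
    rw [Finset.coe_empty, Set.image_empty, IntermediateField.adjoin_empty]
    exact ⟨inferInstance, by simp⟩
  | insert i s hi ih =>
    have := ih.1
    have := IntermediateField.adjoin.finiteDimensional (hx i)
    rw [Finset.coe_insert, Set.image_insert_eq, Set.insert_eq, IntermediateField.adjoin_union,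
      Finset.card_insert_of_notMem hi, pow_succ']
    refine ⟨inferInstance, (IntermediateField.finrank_sup_le _ _).trans
      (Nat.mul_le_mul ?_ ih.2)⟩
    rw [IntermediateField.adjoin.finrank (hx i)]
    exact hd i

/-- If `W` acts on `k(Xᵢ)` by monomial affine transformations lifting a permutation action of its
quotient `P`, and `N` is a monic polynomial of degree `d` invariant under the affine
transformations, then `k(Xᵢ)^W` is the field of `P`-invariants in `k(N(Xᵢ))`, provided that
`#W = d ^ #ι * #P`. -/
lemma nonempty_fixed_algEquiv_fixed {k F E : Type*} [Field k] [Field F] [Field E] [Algebra k F]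
    [Algebra k E]
    {W P : Type*} [Group W] [Finite W] [Group P] [Finite P] [MulSemiringAction W F]
    [MulSemiringAction P E] [FaithfulSMul W F] [FaithfulSMul P E] [SMulCommClass W k F]
    [SMulCommClass P k E] {ι : Type*} [Finite ι] {X : ι → F} {Y : ι → E}
    (hX : AlgebraicIndependent k X) (hX' : IntermediateField.adjoin k (Set.range X) = ⊤)
    (hY : AlgebraicIndependent k Y) (hY' : IntermediateField.adjoin k (Set.range Y) = ⊤)
    (r : W →* P) (σ : P → ι → ι) (α β : W → ι → k)
    (hWX : ∀ w i, w • X i = algebraMap k F (α w i) * X (σ (r w) i) + algebraMap k F (β w i))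
    (hPY : ∀ p i, p • Y i = Y (σ p i))
    (N : Polynomial k) {d : ℕ} (hd : 0 < d) (hN : N.Monic) (hNd : N.natDegree = d)
    (hNαβ : ∀ w i, N.comp (.C (α w i) * .X + .C (β w i)) = N)
    (hcard : Nat.card W = d ^ Nat.card ι * Nat.card P) :
    Nonempty (FixedPoints.intermediateField (F := k) (E := F) W ≃ₐ[k]
      FixedPoints.intermediateField (F := k) (E := E) P) := by
  have := Fintype.ofFinite W
  have := Fintype.ofFinite P
  have := Fintype.ofFinite ι
  have hz : AlgebraicIndependent k fun i ↦ Polynomial.aeval (X i) N :=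
    hX.polynomial_aeval_of_transcendental (f := fun _ ↦ N) fun _ ↦
      N.transcendental (hNd ▸ hd.ne') (by simp [hN.leadingCoeff])
  -- The map `f` identifies `E` with `k(N(X_i))`; it is equivariant along `r` because `N` absorbs
  -- the affine substitutions.
  obtain ⟨f, hf⟩ := hY.exists_algHom hY' hz
  have hequiv (w : W) (y : E) : w • f y = f (r w • y) := by
    have : (MulSemiringAction.toAlgHom k F w).comp f =
        f.comp (MulSemiringAction.toAlgHom k E (r w)) := by
      refine AlgHom.ext_of_adjoin_range_eq_top hY' fun i ↦ ?_
      have h1 : w • Polynomial.aeval (X i) N = Polynomial.aeval (w • X i) N :=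
        (Polynomial.aeval_algHom_apply (MulSemiringAction.toAlgHom k F w) (X i) N).symm
      have h2 : Polynomial.aeval (w • X i) N = Polynomial.aeval (X (σ (r w) i)) N := by
        conv_rhs => rw [← hNαβ w i, Polynomial.aeval_comp]
        simp [hWX]
      simp [hf, hPY, h1, h2]
    exact DFunLike.congr_fun this y
  let _ : Algebra E F := f.toRingHom.toAlgebra
  have : IsScalarTower k E F := .of_algebraMap_eq fun x ↦ (f.commutes x).symm
  set K₀ := FixedPoints.intermediateField (F := k) (E := E) P
  have hSMC : SMulCommClass W K₀ F := ⟨fun w a x ↦ by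
    rw [Algebra.smul_def, Algebra.smul_def, smul_mul']
    congr 1
    exact (hequiv w a).trans (congrArg f (a.2 (r w)))⟩
  let B := FixedPoints.intermediateField (F := K₀) (E := F) W
  have hB : Module.finrank B F = Fintype.card W := FixedPoints.finrank_eq_card W F
  have hEK : Module.finrank K₀ E = Fintype.card P := FixedPoints.finrank_eq_card P E
  have : FiniteDimensional K₀ E :=
    inferInstanceAs (FiniteDimensional (FixedPoints.subfield P E) E)
  -- Over `E`, each `X i` is a root of `N - Y i`, of degree `d`.
  have hFE : FiniteDimensional E F ∧ Module.finrank E F ≤ d ^ Nat.card ι := by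
    have hroot (i : ι) : Polynomial.aeval (X i) (N.map (algebraMap k E) - .C (Y i)) = 0 := by
      rw [map_sub, Polynomial.aeval_map_algebraMap, Polynomial.aeval_C, sub_eq_zero]
      exact (hf i).symm
    have hdeg (i : ι) : (N.map (algebraMap k E) - .C (Y i)).natDegree = d := by
      rw [Polynomial.natDegree_sub_C, hN.natDegree_map, hNd]
    have hmonic (i : ι) : (N.map (algebraMap k E) - .C (Y i)).Monic := by
      refine (hN.map _).sub_of_left (Polynomial.degree_C_le.trans_lt ?_)
      rwa [← Polynomial.natDegree_pos_iff_degree_pos, hN.natDegree_map, hNd]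
    have htop : IntermediateField.adjoin E (X '' (Finset.univ : Finset ι)) = ⊤ := by
      rw [Finset.coe_univ, Set.image_univ]
      have : IntermediateField.adjoin k (Set.range X) ≤
          (IntermediateField.adjoin E (Set.range X)).restrictScalars k :=
        IntermediateField.adjoin_le_iff.2 fun x hx ↦
          (IntermediateField.mem_restrictScalars k).2 (IntermediateField.subset_adjoin E _ hx)
      rw [hX'] at this
      exact eq_top_iff.2 fun x _ ↦ (IntermediateField.mem_restrictScalars k).1
        (this IntermediateField.mem_top)
    have := IntermediateField.finrank_adjoin_image_le (K := E) X d
      (fun i ↦ ⟨_, hmonic i, by simpa [Polynomial.aeval_def] using hroot i⟩)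
      (fun i ↦ (Polynomial.natDegree_le_of_dvd (minpoly.dvd E _ (hroot i))
        (hmonic i).ne_zero).trans_eq (hdeg i)) Finset.univ
    rw [htop, IntermediateField.finrank_top', Finset.card_univ, ← Nat.card_eq_fintype_card] at this
    have := this.1
    exact ⟨IntermediateField.topEquiv.toLinearEquiv.finiteDimensional, ‹_ ∧ _›.2⟩
  have := hFE.1
  have : FiniteDimensional K₀ F := .trans K₀ E F
  -- `[F : K₀] = [F : E] [E : K₀] ≤ d ^ #ι * #P = #W = [F : B]`, while `K₀` lies in `B`.
  have hbot : ⊥ = B := by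
    refine IntermediateField.eq_of_le_of_finrank_le' bot_le ?_
    rw [hB, IntermediateField.finrank_bot', ← Module.finrank_mul_finrank K₀ E F, hEK,
      ← Nat.card_eq_fintype_card, ← Nat.card_eq_fintype_card, hcard, mul_comm]
    exact Nat.mul_le_mul_right _ hFE.2
  have hmap : K₀.map f = FixedPoints.intermediateField (F := k) (E := F) W := by
    ext x
    constructor
    · rintro ⟨y, hy, rfl⟩ w
      exact (hequiv w y).trans (congrArg f (hy (r w)))
    · intro hx
      have hx' : x ∈ B := hx
      rw [← hbot] at hx'
      obtain ⟨y, rfl⟩ := IntermediateField.mem_bot.1 hx'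
      exact ⟨y, y.2, rfl⟩
  exact ⟨((K₀.equivMap f).trans (IntermediateField.equivOfEq hmap)).symm⟩

end Degree

/-- The cyclic group of prime order `ℓ` acts faithfully by affine transformations on the line
over an algebraically closed field, with a monic invariant of degree `ℓ`. -/
lemma exists_affine_action_zmod (k : Type*) [Field k] [IsAlgClosed k] (ℓ : ℕ) [Fact ℓ.Prime] :
    ∃ (a b : ZMod ℓ → k) (N : Polynomial k), a 0 = 1 ∧ b 0 = 0 ∧
      (∀ c c', a (c + c') = a c' * a c) ∧ (∀ c c', b (c + c') = a c' * b c + b c') ∧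
      (∀ c, a c = 1 → b c = 0 → c = 0) ∧ N.Monic ∧ N.natDegree = ℓ ∧
      ∀ c, N.comp (.C (a c) * .X + .C (b c)) = N := by
  have hℓ : ℓ.Prime := Fact.out
  by_cases h : (ℓ : k) = 0
  -- Characteristic `ℓ`: translations by the prime field, with the Artin–Schreier invariant.
  · have : CharP k ℓ := (CharP.charP_iff_prime_eq_zero hℓ).2 h
    have hC (c : ZMod ℓ) : ZMod.castHom dvd_rfl k c ^ ℓ = ZMod.castHom dvd_rfl k c := by
      rw [← map_pow, ZMod.pow_card]
    have hdeg : (Polynomial.X : Polynomial k).degree < ℓ := by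
      rw [Polynomial.degree_X]
      exact_mod_cast hℓ.one_lt
    refine ⟨fun _ ↦ 1, ZMod.castHom dvd_rfl k, .X ^ ℓ - .X, rfl, map_zero _, by simp, by simp, ?_,
      Polynomial.monic_X_pow_sub (by simpa using hℓ.one_lt), ?_, fun c ↦ ?_⟩
    · exact fun c _ hc ↦ (map_eq_zero_iff _ (ZMod.castHom_injective k)).1 hc
    · exact Polynomial.natDegree_eq_of_degree_eq_some (by
        rw [Polynomial.degree_sub_eq_left_of_degree_lt (by simpa using hdeg),
          Polynomial.degree_X_pow])
    · rw [Polynomial.C_1, one_mul, Polynomial.sub_comp, Polynomial.X_pow_comp, Polynomial.X_comp,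
        add_pow_char, ← Polynomial.C_pow, hC]
      ring
  -- Other characteristics: multiplication by `ℓ`-th roots of unity, with the Kummer invariant.
  · obtain ⟨ζ, hζ⟩ : ∃ ζ : k, IsPrimitiveRoot ζ ℓ := by
      have : NeZero (ℓ : k) := ⟨h⟩
      exact HasEnoughRootsOfUnity.exists_primitiveRoot k ℓ
    refine ⟨fun c ↦ ζ ^ c.val, fun _ ↦ 0, .X ^ ℓ, by simp, rfl, fun c c' ↦ ?_, by simp,
      fun c hc _ ↦ ?_, Polynomial.monic_X_pow _, Polynomial.natDegree_X_pow _, fun c ↦ ?_⟩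
    · dsimp only
      rw [ZMod.val_add, ← pow_add, add_comm c'.val, ← pow_eq_pow_mod _ hζ.pow_eq_one]
    · exact (ZMod.val_eq_zero c).1 (Nat.eq_zero_of_dvd_of_lt (hζ.dvd_of_pow_eq_one _ hc) c.val_lt)
    · rw [Polynomial.C_0, add_zero, Polynomial.X_pow_comp, mul_pow, ← Polynomial.C_pow, ← pow_mul,
        mul_comm c.val, pow_mul, hζ.pow_eq_one, one_pow, Polynomial.C_1, one_mul]

/-! ### Wreath products and Sylow subgroups of symmetric groups -/

section Sylow

/-- The wreath product of the cyclic group of order `ℓ` with a permutation group. -/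
abbrev CyclicWreathProduct (ℓ : ℕ) {ι : Type} (P : Subgroup (Equiv.Perm ι)) : Type :=
  (ι → Multiplicative (ZMod ℓ)) ⋊[mulAutArrow] P

namespace CyclicWreathProduct

variable {ℓ : ℕ} {ι : Type} {P : Subgroup (Equiv.Perm ι)}

/-- Reading the left component at the image of `i` turns multiplication into the cocycle identity
required by the actions below. -/
lemma left_mul_apply (v w : CyclicWreathProduct ℓ P) (i : ι) :
    (v * w).left ((v * w).right.1 i) =
      v.left (v.right.1 (w.right.1 i)) * w.left (w.right.1 i) := by
  rw [SemidirectProduct.mul_left, SemidirectProduct.mul_right, Pi.mul_apply]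
  congr 1
  exact congrArg w.left (Equiv.symm_apply_apply v.right.1 (w.right.1 i))

lemma eq_one (w : CyclicWreathProduct ℓ P) (h₁ : ∀ i, w.right.1 i = i) (h₂ : ∀ i, w.left i = 1) :
    w = 1 :=
  SemidirectProduct.ext (funext h₂) (Subtype.ext (Equiv.ext h₁))

variable (ℓ P) in
/-- The imprimitive action of the wreath product. -/
def toPerm : CyclicWreathProduct ℓ P →* Equiv.Perm (ι × Multiplicative (ZMod ℓ)) :=
  let _ : MulAction (CyclicWreathProduct ℓ P) (ι × Multiplicative (ZMod ℓ)) :=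
    { smul := fun w x ↦ (w.right.1 x.1, w.left (w.right.1 x.1) * x.2)
      one_smul := fun x ↦ Prod.ext rfl (one_mul _)
      mul_smul := fun v w x ↦ Prod.ext rfl (by
        change (v * w).left ((v * w).right.1 x.1) * x.2 = _ * (_ * x.2)
        rw [left_mul_apply, mul_assoc]
        rfl) }
  MulAction.toPermHom _ _

lemma toPerm_apply (w : CyclicWreathProduct ℓ P) (x : ι × Multiplicative (ZMod ℓ)) :
    toPerm ℓ P w x = (w.right.1 x.1, w.left (w.right.1 x.1) * x.2) := rfl

lemma toPerm_injective : Function.Injective (toPerm ℓ P) := by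
  rw [injective_iff_map_eq_one]
  intro w hw
  have h (i : ι) : w.right.1 i = i ∧ w.left (w.right.1 i) = 1 := by
    have := DFunLike.congr_fun hw (i, 1)
    rw [toPerm_apply] at this
    exact ⟨congrArg Prod.fst this, by simpa using congrArg Prod.snd this⟩
  refine w.eq_one (fun i ↦ (h i).1) fun i ↦ ?_
  conv_lhs => rw [← (h i).1]
  exact (h i).2

lemma card [Finite ι] [NeZero ℓ] :
    Nat.card (CyclicWreathProduct ℓ P) = ℓ ^ Nat.card ι * Nat.card P := by
  rw [SemidirectProduct.card, Nat.card_fun]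
  congr 2
  simp

end CyclicWreathProduct

/-- The Sylow `ℓ`-subgroups of the symmetric group on `n` letters are wreath products of a cyclic
group with a Sylow subgroup of the symmetric group on `n / ℓ` letters. -/
lemma Sylow.nonempty_mulEquiv_cyclicWreathProduct {ℓ : ℕ} [Fact ℓ.Prime] {n : ℕ}
    (G : Sylow ℓ (Equiv.Perm (Fin n))) (P : Sylow ℓ (Equiv.Perm (Fin (n / ℓ)))) :
    Nonempty (G ≃* CyclicWreathProduct ℓ P.1) := by
  have hℓ : ℓ.Prime := Fact.out
  have : NeZero ℓ := ⟨hℓ.ne_zero⟩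
  have : Fintype (Fin (n / ℓ) × Multiplicative (ZMod ℓ)) := Fintype.ofFinite _
  -- These are `n / ℓ` disjoint blocks of `ℓ` letters; the remaining `n % ℓ` letters will be fixed.
  obtain ⟨j⟩ : Nonempty (Fin (n / ℓ) × Multiplicative (ZMod ℓ) ↪ Fin n) := by
    refine Function.Embedding.nonempty_of_card_le ?_
    rw [← Nat.card_eq_fintype_card, Nat.card_prod]
    simpa using Nat.div_mul_le_self n ℓ
  let h := (Equiv.Perm.viaEmbeddingHom j).comp (CyclicWreathProduct.toPerm ℓ P.1)
  have hinj : Function.Injective h :=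
    (Equiv.Perm.viaEmbeddingHom_injective j).comp CyclicWreathProduct.toPerm_injective
  -- Legendre's recursion: the `ℓ`-adic valuation of `n!` is `n / ℓ` plus that of `(n / ℓ)!`.
  have hcard : Nat.card h.range = ℓ ^ (Nat.card (Equiv.Perm (Fin n))).factorization ℓ := by
    rw [← Nat.card_congr (MonoidHom.ofInjective hinj).toEquiv, CyclicWreathProduct.card,
      P.card_eq_multiplicity, Nat.card_perm, Nat.card_perm, Nat.card_fin, Nat.card_fin,
      Nat.factorization_def _ hℓ, Nat.factorization_def _ hℓ, ← pow_add,
      ← padicValNat_mul_div_factorial n, padicValNat_factorial_mul, add_comm]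
  exact ⟨(G.equiv (Sylow.ofCard h.range hcard)).trans (MonoidHom.ofInjective hinj).symm⟩

end Sylow

/-! ### The induction on the number of letters -/

/-- The field of invariants of a Sylow `ℓ`-subgroup `G` of a symmetric group acting faithfully,
by affine transformations, on a rational function field is stably rational. -/
theorem Sylow.isStablyRationalField_fixed (k : Type u) [Field k] [IsAlgClosed k] (ℓ : ℕ)
    [Fact ℓ.Prime] (n : ℕ) (G : Sylow ℓ (Equiv.Perm (Fin n))) (K : Type u) [Field K] [Algebra k K]
    [MulSemiringAction G K] [FaithfulSMul G K] [SMulCommClass G k K] {ι : Type} [Finite ι]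
    {y : ι → K} (hy : AlgebraicIndependent k y)
    (hy' : IntermediateField.adjoin k (Set.range y) = ⊤)
    (hG : ∀ (g : G) i, g • y i ∈ Submodule.span k (insert 1 (Set.range y))) :
    IsStablyRationalField k (FixedPoints.intermediateField (F := k) (E := K) G) := by
  induction n using Nat.strong_induction_on generalizing K ι with
  | _ n ih =>
  have hℓ : ℓ.Prime := Fact.out
  have : NeZero ℓ := ⟨hℓ.ne_zero⟩
  obtain rfl | hn := Nat.eq_zero_or_pos n
  · have htop : FixedPoints.intermediateField (F := k) (E := K) G = ⊤ :=
      eq_top_iff.2 fun x _ g ↦ by rw [Subsingleton.elim g 1, one_smul]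
    exact .of_algEquiv ((IntermediateField.equivOfEq htop).trans IntermediateField.topEquiv)
      (IsRationalExtension.of_finite hy hy').isStablyRationalField
  obtain ⟨P⟩ : Nonempty (Sylow ℓ (Equiv.Perm (Fin (n / ℓ)))) := inferInstance
  obtain ⟨e⟩ := G.nonempty_mulEquiv_cyclicWreathProduct P
  obtain ⟨a, b, N, ha₀, hb₀, ha, hb, hab, hN, hNd, hNab⟩ := exists_affine_action_zmod k ℓ
  let π : G →* Equiv.Perm (Fin (n / ℓ)) :=
    (P.1.subtype.comp SemidirectProduct.rightHom).comp e.toMonoidHom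
  let c : G → Fin (n / ℓ) → ZMod ℓ := fun g i ↦ ((e g).left (π g i)).toAdd
  have hc₁ (i) : c 1 i = 0 := by simp [c]
  have hc (g h i) : c (g * h) i = c g (π h i) + c h i := by
    have := CyclicWreathProduct.left_mul_apply (e g) (e h) i
    rw [← map_mul] at this
    exact this
  have hfaithful (g : G) (h : ∀ i, π g i = i ∧ a (c g i) = 1 ∧ b (c g i) = 0) : g = 1 := by
    rw [← map_eq_one_iff e e.injective]
    refine CyclicWreathProduct.eq_one _ (fun i ↦ (h i).1) fun i ↦ ?_
    have := hab _ (h i).2.1 (h i).2.2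
    rw [← (h i).1]
    exact this
  -- `L = K(X)` is the joint field, `F = k(Z)` the model for `G`, and `E = k(Y)` the permutation
  -- field of `P` to which the induction hypothesis applies.
  obtain ⟨L, _, _, _, _, _, _, _, X, hX, hX', hGX⟩ :=
    exists_monomialAffine_extension (K := K) π (fun g i ↦ a (c g i)) (fun g i ↦ b (c g i))
      (by simp [hc₁, ha₀]) (by simp [hc₁, hb₀]) (by simp [hc, ha]) (by simp [hc, hb])
  obtain ⟨F, _, _, _, _, _, Z, hZ, hZ', hGZ⟩ :=
    exists_monomialAffine_field k π (fun g i ↦ a (c g i)) (fun g i ↦ b (c g i))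
      (by simp [hc₁, ha₀]) (by simp [hc₁, hb₀]) (by simp [hc, ha]) (by simp [hc, hb]) hfaithful
  obtain ⟨E, _, _, _, _, _, Y, hY, hY', hPY⟩ :=
    exists_monomialAffine_field k P.1.subtype (fun _ _ ↦ 1) (fun _ _ ↦ 0)
      (by simp) (by simp) (by simp) (by simp)
      fun p hp ↦ Subtype.ext (Equiv.ext fun i ↦ (hp i).1)
  simp only [map_one, map_zero, one_mul, add_zero] at hPY
  have hE := ih (n / ℓ) (Nat.div_lt_self hn hℓ.one_lt) P E hY hY' fun p i ↦ by
    rw [hPY]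
    exact Submodule.subset_span (.inr ⟨_, rfl⟩)
  obtain ⟨e'⟩ := nonempty_fixed_algEquiv_fixed hZ hZ' hY hY'
    (SemidirectProduct.rightHom.comp e.toMonoidHom) (fun p i ↦ p.1 i) _ _ hGZ hPY N hℓ.pos hN hNd
    (fun w i ↦ hNab _) (by rw [Nat.card_congr e.toEquiv, CyclicWreathProduct.card])
  have hF := hE.of_algEquiv e'
  -- Sending `Z` to `X` embeds `F` equivariantly in `L`, so that `L = K(X) = F(y)` and the no-name
  -- lemma applies over both `K` and `F`.
  obtain ⟨f, hf⟩ := hZ.exists_algHom hZ' (hX.restrictScalars (algebraMap k K).injective)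
  let _ : Algebra F L := f.toRingHom.toAlgebra
  have : IsScalarTower k F L := .of_algebraMap_eq fun x ↦ (f.commutes x).symm
  have hequiv (g : G) (x : F) : g • f x = f (g • x) := by
    have : (MulSemiringAction.toAlgHom k L g).comp f =
        f.comp (MulSemiringAction.toAlgHom k F g) :=
      AlgHom.ext_of_adjoin_range_eq_top hZ' fun i ↦ by simp [hf, hGX, hGZ]
    exact DFunLike.congr_fun this x
  have : SMulDistribClass G F L := ⟨fun g x z ↦ by
    rw [Algebra.smul_def, Algebra.smul_def, smul_mul']
    exact congrArg (· * _) (hequiv g x)⟩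
  obtain rfl : algebraMap F L ∘ Z = X := funext hf
  have h₁ := isStablyRationalField_fixed_iff (k := k) (G := G) hX hX' fun g i ↦ by
    rw [hGX, ← Algebra.smul_def, Algebra.algebraMap_eq_smul_one]
    exact Submodule.add_mem _
      (Submodule.smul_of_tower_mem _ _ (Submodule.subset_span (.inr ⟨_, rfl⟩)))
      (Submodule.smul_of_tower_mem _ _ (Submodule.subset_span (.inl rfl)))
  have h₂ := isStablyRationalField_fixed_iff (k := k) (G := G)
    (AlgebraicIndependent.swap (E := k) hZ' hy hX) (IntermediateField.adjoin_swap hy' hX')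
    fun g i ↦ by
      have hle : Submodule.span k (insert 1 (Set.range y)) ≤
          ((Submodule.span F (insert 1 (Set.range (algebraMap K L ∘ y)))).restrictScalars k).comap
            (IsScalarTower.toAlgHom k K L).toLinearMap := by
        refine Submodule.span_le.2 ?_
        rintro _ (rfl | ⟨j, rfl⟩)
        · exact Submodule.subset_span (.inl (map_one (algebraMap K L)))
        · exact Submodule.subset_span (.inr ⟨j, rfl⟩)
      have hgy : g • algebraMap K L (y i) = algebraMap K L (g • y i) := by
        rw [Algebra.algebraMap_eq_smul_one, smul_distrib_smul, smul_one,
          Algebra.algebraMap_eq_smul_one]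
      exact hgy ▸ hle (hG g i)
  exact h₁.2 (h₂.1 hF)

/-! ### From function fields to birational schemes -/

section Localization

/-- If `A ⊆ C` are domains with the same fraction field and `C` is finitely generated over `A`,
then `A` and `C` have a common localization at a nonzero element of `A`. -/
lemma exists_isLocalization_away_of_finiteType (A C K : Type*) [CommRing A] [CommRing C] [Field K]
    [Algebra A C] [Algebra A K] [Algebra C K] [IsScalarTower A C K] [IsDomain A] [IsFractionRing A K]
    [FaithfulSMul C K] [Algebra.FiniteType A C] :
    ∃ a : A, a ≠ 0 ∧ IsLocalization.Away a (Localization.Away (algebraMap A C a)) := by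
  classical
  have hAC : Function.Injective (algebraMap A C) := by
    have := IsFractionRing.injective A K
    rw [IsScalarTower.algebraMap_eq A C K] at this
    exact .of_comp this
  have hCK : Function.Injective (algebraMap C K) := FaithfulSMul.algebraMap_injective C K
  have : IsDomain C := hCK.isDomain _
  obtain ⟨s, hs⟩ := Algebra.FiniteType.out (R := A) (A := C)
  -- `a` is a common denominator for the finitely many generators of `C`.
  obtain ⟨⟨a, ha⟩, hint⟩ := IsLocalization.exist_integer_multiples_of_finset
    (nonZeroDivisors A) (s.image (algebraMap C K))
  have ha₀ : a ≠ 0 := nonZeroDivisors.ne_zero ha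
  have hden (c : C) : ∃ (n : ℕ) (x : A), algebraMap A C a ^ n * c = algebraMap A C x := by
    have hc : c ∈ Algebra.adjoin A (s : Set C) := hs ▸ Algebra.mem_top
    induction hc using Algebra.adjoin_induction with
    | mem c hc =>
      obtain ⟨x, hx⟩ := hint _ (Finset.mem_image_of_mem _ hc)
      refine ⟨1, x, hCK ?_⟩
      rw [← IsScalarTower.algebraMap_apply, hx, pow_one, map_mul, Algebra.smul_def,
        ← IsScalarTower.algebraMap_apply]
    | algebraMap x => exact ⟨0, x, by simp⟩
    | add c c' _ _ hc hc' =>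
      obtain ⟨n, x, hx⟩ := hc
      obtain ⟨m, y, hy⟩ := hc'
      refine ⟨n + m, a ^ m * x + a ^ n * y, ?_⟩
      rw [map_add, map_mul, map_mul, ← hx, ← hy, map_pow, map_pow]
      ring
    | mul c c' _ _ hc hc' =>
      obtain ⟨n, x, hx⟩ := hc
      obtain ⟨m, y, hy⟩ := hc'
      refine ⟨n + m, x * y, ?_⟩
      rw [map_mul, ← hx, ← hy]
      ring
  refine ⟨a, ha₀, ?_⟩
  set B := Localization.Away (algebraMap A C a)
  have hCB : Function.Injective (algebraMap C B) :=
    IsLocalization.injective B (powers_le_nonZeroDivisors_of_noZeroDivisors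
      (by simpa using (map_ne_zero_iff _ hAC).2 ha₀))
  have hAB (x : A) : algebraMap A B x = algebraMap C B (algebraMap A C x) :=
    IsScalarTower.algebraMap_apply A C B x
  have hunit : IsUnit (algebraMap A B a) := hAB a ▸ IsLocalization.Away.algebraMap_isUnit (S := B) (algebraMap A C a)
  refine ⟨?_, ?_, ?_⟩
  · rintro ⟨_, n, rfl⟩
    simpa using hunit.pow n
  · intro z
    obtain ⟨⟨c, ⟨_, n, rfl⟩⟩, hz⟩ := IsLocalization.surj (Submonoid.powers (algebraMap A C a)) z
    obtain ⟨m, x, hx⟩ := hden c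
    refine ⟨(x, ⟨a ^ (n + m), n + m, rfl⟩), ?_⟩
    simp only at hz ⊢
    rw [map_pow] at hz
    change z * algebraMap C B (algebraMap A C a) ^ n = algebraMap C B c at hz
    rw [hAB x, ← hx, map_mul, ← hz, hAB, map_pow, map_pow, map_pow, pow_add]
    ring
  · intro x y hxy
    rw [hAB, hAB] at hxy
    exact ⟨1, by rw [hAC (hCB hxy)]⟩

end Localization

section Birational

lemma AlgebraicGeometry.isDominant_SpecMap_of_injective {A B : Type u} [CommRing A] [CommRing B]
    (f : A →+* B) (hf : Function.Injective f) :
    IsDominant (Spec.map (CommRingCat.ofHom f)) where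
  denseRange := by
    refine (PrimeSpectrum.denseRange_comap_iff_ker_le_nilRadical f).2 ?_
    rw [(RingHom.injective_iff_ker_eq_bot f).1 hf]
    exact bot_le

lemma AlgebraicGeometry.birationalOver_Spec_localization {k A B : Type u} [CommRing k] [CommRing A]
    [CommRing B]
    [Algebra k A] [Algebra A B] [Algebra k B] [IsScalarTower k A B] [IsDomain A] (a : A)
    (ha : a ≠ 0) [IsLocalization.Away a B] :
    Scheme.BirationalOver (Spec.map (CommRingCat.ofHom (algebraMap k B)))
      (Spec.map (CommRingCat.ofHom (algebraMap k A))) := by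
  have : IsOpenImmersion (Spec.map (CommRingCat.ofHom (algebraMap A B))) :=
    IsOpenImmersion.of_isLocalization a
  have := isDominant_SpecMap_of_injective (algebraMap A B)
    (IsLocalization.injective B (powers_le_nonZeroDivisors_of_noZeroDivisors ha))
  refine Scheme.Hom.birationalOver (Spec.map (CommRingCat.ofHom (algebraMap A B))) _ _ ?_
  rw [← Spec.map_comp, ← CommRingCat.ofHom_comp, ← IsScalarTower.algebraMap_eq]

/-- A common localization gives a common dense open subscheme of the two spectra. -/
lemma AlgebraicGeometry.birationalOver_Spec_of_finiteType {k A C K : Type u} [CommRing k]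
    [CommRing A] [CommRing C]
    [Field K] [Algebra k A] [Algebra k C]
    [Algebra A C] [Algebra A K] [Algebra C K] [IsScalarTower A C K] [IsScalarTower k A C]
    [IsDomain A] [IsFractionRing A K] [FaithfulSMul C K] [Algebra.FiniteType A C] :
    Scheme.BirationalOver (Spec.map (CommRingCat.ofHom (algebraMap k A)))
      (Spec.map (CommRingCat.ofHom (algebraMap k C))) := by
  obtain ⟨a, ha, h⟩ := exists_isLocalization_away_of_finiteType A C K
  have : IsDomain C := (FaithfulSMul.algebraMap_injective C K).isDomain _
  have hAC : Function.Injective (algebraMap A C) := by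
    have := IsFractionRing.injective A K
    rw [IsScalarTower.algebraMap_eq A C K] at this
    exact .of_comp this
  have : IsScalarTower k A (Localization.Away (algebraMap A C a)) := .of_algebraMap_eq fun x ↦ by
    rw [IsScalarTower.algebraMap_apply k C, IsScalarTower.algebraMap_apply k A C,
      ← IsScalarTower.algebraMap_apply A C]
  exact (birationalOver_Spec_localization (B := Localization.Away (algebraMap A C a)) a ha).symm.trans
    (birationalOver_Spec_localization (algebraMap A C a) ((map_ne_zero_iff _ hAC).2 ha))

/-- Finitely generated domains over `k` with the same fraction field have birational spectra. -/
lemma AlgebraicGeometry.birationalOver_Spec_of_isFractionRing {k A B : Type u} (K : Type u)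
    [Field k] [CommRing A] [CommRing B] [Field K] [Algebra k A] [Algebra k B] [Algebra k K]
    [Algebra A K] [Algebra B K] [IsScalarTower k A K] [IsScalarTower k B K] [IsDomain A]
    [IsDomain B] [IsFractionRing A K] [IsFractionRing B K] [Algebra.FiniteType k A]
    [Algebra.FiniteType k B] :
    Scheme.BirationalOver (Spec.map (CommRingCat.ofHom (algebraMap k A)))
      (Spec.map (CommRingCat.ofHom (algebraMap k B))) := by
  let f := IsScalarTower.toAlgHom k A K
  let g := IsScalarTower.toAlgHom k B K
  -- The compositum of `A` and `B` in `K` is of finite type over each of them, so both compare with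
  -- it.
  let C := f.range ⊔ g.range
  have hC : C.FG := by
    refine Subalgebra.FG.sup ?_ ?_
    · rw [← Algebra.map_top]
      exact Algebra.FiniteType.out.map f
    · rw [← Algebra.map_top]
      exact Algebra.FiniteType.out.map g
  have : Algebra.FiniteType k C := C.fg_iff_finiteType.1 hC
  let _ : Algebra A C :=
    ((Subalgebra.inclusion (le_sup_left : f.range ≤ C)).comp f.rangeRestrict).toRingHom.toAlgebra
  let _ : Algebra B C :=
    ((Subalgebra.inclusion (le_sup_right : g.range ≤ C)).comp g.rangeRestrict).toRingHom.toAlgebra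
  have : IsScalarTower A C K := .of_algebraMap_eq fun _ ↦ rfl
  have : IsScalarTower B C K := .of_algebraMap_eq fun _ ↦ rfl
  have : IsScalarTower k A C := .of_algebraMap_eq fun x ↦
    Subtype.ext (IsScalarTower.algebraMap_apply k A K x)
  have : IsScalarTower k B C := .of_algebraMap_eq fun x ↦
    Subtype.ext (IsScalarTower.algebraMap_apply k B K x)
  have : Algebra.FiniteType A C := .of_restrictScalars_finiteType k A C
  have : Algebra.FiniteType B C := .of_restrictScalars_finiteType k B C
  exact (birationalOver_Spec_of_finiteType (A := A) (C := C) (K := K)).trans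
    (birationalOver_Spec_of_finiteType (A := B) (C := C) (K := K)).symm

lemma AlgebraicGeometry.birationalOver_affineSpace {k A : Type u} [CommRing k] [CommRing A]
    [Algebra k A] (n : Type u) :
    Scheme.BirationalOver ((𝔸(n; Spec (CommRingCat.of A)) ↘ Spec (CommRingCat.of A)) ≫
        Spec.map (CommRingCat.ofHom (algebraMap k A)))
      (Spec.map (CommRingCat.ofHom (algebraMap k (MvPolynomial n A)))) := by
  refine (Scheme.Hom.birationalOver (AffineSpace.SpecIso n (CommRingCat.of A)).inv _ _ ?_).symm
  rw [← Category.assoc, AffineSpace.SpecIso_inv_over, ← Spec.map_comp, ← CommRingCat.ofHom_comp]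
  rfl

/-- A polynomial ring over a domain with fraction field `E` has fraction field `M`, if `M` is
generated over `E` by algebraically independent elements. -/
lemma isFractionRing_mvPolynomial {A E M : Type*} [CommRing A] [IsDomain A] [Field E] [Field M]
    [Algebra A E] [IsFractionRing A E] [Algebra E M] [Algebra A M] [IsScalarTower A E M]
    {ι : Type*} {t : ι → M} (ht : AlgebraicIndependent E t)
    (ht' : IntermediateField.adjoin E (Set.range t) = ⊤) :
    letI := (MvPolynomial.aeval (R := A) t).toRingHom.toAlgebra
    IsFractionRing (MvPolynomial ι A) M := by
  let _ := (MvPolynomial.aeval (R := A) t).toRingHom.toAlgebra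
  have hA : AlgebraicIndependent A t := ht.restrictScalars (IsFractionRing.injective A E)
  have : FaithfulSMul (MvPolynomial ι A) M := (faithfulSMul_iff_algebraMap_injective _ _).2
    (algebraicIndependent_iff_injective_aeval.1 hA)
  have hE (p : MvPolynomial ι E) : ∃ (q : MvPolynomial ι A) (c : A),
      algebraMap A M c ≠ 0 ∧ MvPolynomial.aeval t p = MvPolynomial.aeval t q / algebraMap A M c := by
    induction p using MvPolynomial.induction_on with
    | C x =>
      obtain ⟨a, b, hb, rfl⟩ := IsFractionRing.div_surjective A x
      refine ⟨.C a, b, ?_, by simp [← IsScalarTower.algebraMap_apply]⟩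
      rw [IsScalarTower.algebraMap_apply A E M, map_ne_zero]
      exact IsFractionRing.to_map_ne_zero_of_mem_nonZeroDivisors hb
    | add p p' hp hp' =>
      obtain ⟨q, c, hc, h⟩ := hp
      obtain ⟨q', c', hc', h'⟩ := hp'
      refine ⟨q * .C c' + .C c * q', c * c', by simp [hc, hc'], ?_⟩
      rw [map_add, h, h', div_add_div _ _ hc hc']
      simp
    | mul_X p i hp =>
      obtain ⟨q, c, hc, h⟩ := hp
      exact ⟨q * .X i, c, hc, by rw [map_mul, h, map_mul]; simp; ring⟩
  refine .of_field _ _ fun z ↦ ?_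
  have hz : z ∈ IntermediateField.adjoin E (Set.range t) := ht' ▸ IntermediateField.mem_top
  obtain ⟨r, s, rfl⟩ := (IntermediateField.mem_adjoin_range_iff E t z).1 hz
  obtain ⟨q, c, -, h⟩ := hE r
  obtain ⟨q', c', -, h'⟩ := hE s
  refine ⟨q * .C c', q' * .C c, ?_⟩
  rw [h, h', map_mul, map_mul, div_div_div_eq, mul_comm (algebraMap A M c)]
  congr 2 <;> exact (MvPolynomial.aeval_C _ _).symm

/-- The field witnessing stable rationality is the fraction field of polynomial rings over both `A`
and `k`. -/
lemma AlgebraicGeometry.isStablyRationalOver_Spec {k A E : Type u} [Field k] [CommRing A]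
    [IsDomain A] [Field E] [Algebra k A] [Algebra A E] [Algebra k E] [IsScalarTower k A E]
    [IsFractionRing A E] [Algebra.FiniteType k A] (h : IsStablyRationalField k E) :
    Scheme.IsStablyRationalOver (Spec.map (CommRingCat.ofHom (algebraMap k A))) := by
  obtain ⟨M, _, _, _, _, ⟨r, t, ht, ht'⟩, ⟨m, s, hs, hs'⟩⟩ := h
  refine ⟨r, m, ?_⟩
  let _ : Algebra A M := ((algebraMap E M).comp (algebraMap A E)).toAlgebra
  have : IsScalarTower A E M := .of_algebraMap_eq fun _ ↦ rfl
  have : IsScalarTower k A M := .of_algebraMap_eq fun x ↦ by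
    rw [IsScalarTower.algebraMap_apply k E M, IsScalarTower.algebraMap_apply k A E,
      ← IsScalarTower.algebraMap_apply A E M]
  let t' : ULift.{u} (Fin r) → M := t ∘ ULift.down
  let s' : ULift.{u} (Fin m) → M := s ∘ ULift.down
  let _ := (MvPolynomial.aeval (R := A) t').toRingHom.toAlgebra
  let _ := (MvPolynomial.aeval (R := k) s').toRingHom.toAlgebra
  have h₁ : IsFractionRing (MvPolynomial (ULift.{u} (Fin r)) A) M :=
    isFractionRing_mvPolynomial (E := E) (t := t') (ht.comp _ ULift.down_injective)
      (by rwa [ULift.down_surjective.range_comp])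
  have h₂ : IsFractionRing (MvPolynomial (ULift.{u} (Fin m)) k) M :=
    isFractionRing_mvPolynomial (E := k) (t := s') (hs.comp _ ULift.down_injective)
      (by rwa [ULift.down_surjective.range_comp])
  have : IsScalarTower k (MvPolynomial (ULift.{u} (Fin r)) A) M := .of_algebraMap_eq fun x ↦ by
    refine (IsScalarTower.algebraMap_apply k A M x).trans ?_
    exact (MvPolynomial.aeval_C t' _).symm
  have : IsScalarTower k (MvPolynomial (ULift.{u} (Fin m)) k) M := .of_algebraMap_eq fun x ↦
    (MvPolynomial.aeval_C s' _).symm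
  have : Algebra.FiniteType k (MvPolynomial (ULift.{u} (Fin r)) A) :=
    .trans (S := A) inferInstance inferInstance
  refine (birationalOver_affineSpace _).trans ((birationalOver_Spec_of_isFractionRing
    (A := MvPolynomial (ULift.{u} (Fin r)) A) (B := MvPolynomial (ULift.{u} (Fin m)) k) M).trans ?_)
  have := birationalOver_affineSpace (k := k) (A := k) (ULift.{u} (Fin m))
  simpa using this.symm

end Birational

/-! ### Invariant rings and their fraction fields -/

namespace Representation

variable {k V G : Type*} [Field k] [Group G] [AddCommGroup V] [Module k V]
  (ρ : Representation k G V)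

@[simp]
lemma coordinateMap_ι (g : G) (φ : Module.Dual k V) :
    ρ.coordinateMap g (SymmetricAlgebra.ι k _ φ) = SymmetricAlgebra.ι k _ (ρ.dual g φ) := by
  simp [coordinateMap]

lemma coordinateMap_one : ρ.coordinateMap 1 = AlgHom.id k _ :=
  SymmetricAlgebra.algHom_ext (LinearMap.ext fun φ ↦ by
    change ρ.coordinateMap 1 (SymmetricAlgebra.ι k _ φ) = SymmetricAlgebra.ι k _ φ
    rw [coordinateMap_ι, map_one]
    rfl)

lemma coordinateMap_mul (g h : G) :
    ρ.coordinateMap (g * h) = (ρ.coordinateMap g).comp (ρ.coordinateMap h) :=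
  SymmetricAlgebra.algHom_ext (LinearMap.ext fun φ ↦ by
    change ρ.coordinateMap (g * h) (SymmetricAlgebra.ι k _ φ) =
      ρ.coordinateMap g (ρ.coordinateMap h (SymmetricAlgebra.ι k _ φ))
    rw [coordinateMap_ι, coordinateMap_ι, coordinateMap_ι, map_mul]
    rfl)

/-- The action of `G` on the coordinate ring of a representation. -/
abbrev coordinateAction : MulSemiringAction G (SymmetricAlgebra k (Module.Dual k V)) where
  smul g f := ρ.coordinateMap g f
  one_smul f := DFunLike.congr_fun ρ.coordinateMap_one f
  mul_smul g h f := DFunLike.congr_fun (ρ.coordinateMap_mul g h) f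
  smul_zero g := map_zero (ρ.coordinateMap g)
  smul_add g := map_add (ρ.coordinateMap g)
  smul_one g := map_one (ρ.coordinateMap g)
  smul_mul g := map_mul (ρ.coordinateMap g)

lemma isInvariant_invariantRing :
    letI := ρ.coordinateAction
    Algebra.IsInvariant ρ.invariantRing (SymmetricAlgebra k (Module.Dual k V)) G :=
  let _ := ρ.coordinateAction
  ⟨fun f hf ↦ ⟨⟨f, hf⟩, rfl⟩⟩

lemma smulCommClass_invariantRing :
    letI := ρ.coordinateAction
    SMulCommClass G ρ.invariantRing (SymmetricAlgebra k (Module.Dual k V)) :=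
  let _ := ρ.coordinateAction
  ⟨fun g a f ↦ by
    rw [Algebra.smul_def, Algebra.smul_def, smul_mul']
    exact congrArg (· * _) (a.2 g)⟩

variable [FiniteDimensional k V]

instance : Algebra.FiniteType k (SymmetricAlgebra k (Module.Dual k V)) :=
  .equiv inferInstance
    (SymmetricAlgebra.equivMvPolynomial (Module.finBasis k (Module.Dual k V))).symm

/-- The ring of invariants of a finite group is finitely generated. -/
lemma finiteType_invariantRing [Finite G] : Algebra.FiniteType k ρ.invariantRing := by
  let _ := ρ.coordinateAction
  have := ρ.smulCommClass_invariantRing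
  have := ρ.isInvariant_invariantRing
  -- Noether's argument: the coordinate ring is integral and of finite type, hence finite, over the
  -- invariants; the Artin–Tate lemma concludes.
  have hint := Algebra.IsInvariant.isIntegral ρ.invariantRing
    (SymmetricAlgebra k (Module.Dual k V)) G
  have : Algebra.FiniteType ρ.invariantRing (SymmetricAlgebra k (Module.Dual k V)) :=
    .of_restrictScalars_finiteType k _ _
  have hfin : Module.Finite ρ.invariantRing (SymmetricAlgebra k (Module.Dual k V)) :=
    Algebra.IsIntegral.finite
  exact ⟨fg_of_fg_of_fg k ρ.invariantRing (SymmetricAlgebra k (Module.Dual k V))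
    Algebra.FiniteType.out hfin.1 Subtype.val_injective⟩

end Representation

section

variable {k V : Type u} {G : Type*} [Field k] [Group G] [Finite G] [AddCommGroup V] [Module k V]
  [FiniteDimensional k V]

lemma IsFractionRing.generators_of_equiv {k S K ι : Type*} [Field k] [CommRing S] [Field K]
    [Algebra k S] [Algebra k K] [Algebra S K] [IsScalarTower k S K] [IsFractionRing S K]
    (e : MvPolynomial ι k ≃ₐ[k] S) :
    AlgebraicIndependent k (fun i ↦ algebraMap S K (e (.X i))) ∧
      IntermediateField.adjoin k (Set.range fun i ↦ algebraMap S K (e (.X i))) = ⊤ := by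
  let _ : Algebra (MvPolynomial ι k) K := ((algebraMap S K).comp e.toRingHom).toAlgebra
  have : IsScalarTower k (MvPolynomial ι k) K := .of_algebraMap_eq fun x ↦ by
    rw [IsScalarTower.algebraMap_apply k S K, ← e.commutes]
    rfl
  have : IsFractionRing (MvPolynomial ι k) K :=
    IsFractionRing.of_ringEquiv_left e.toRingEquiv fun x ↦ rfl
  exact ⟨IsFractionRing.algebraicIndependent_of_mvPolynomial,
    IsFractionRing.adjoin_eq_top_of_mvPolynomial⟩

/-- The fraction field of a ring of invariants is the field of invariants. -/
lemma nonempty_fractionRing_algEquiv_fixed (k A S K : Type*) (G : Type*) [Field k] [CommRing A]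
    [CommRing S] [IsDomain A] [Field K] [Algebra k A] [Algebra k S] [Algebra k K] [Algebra A S]
    [Algebra S K] [Algebra A K] [IsScalarTower A S K] [IsScalarTower k A K] [IsFractionRing S K]
    [Group G] [Finite G]
    [MulSemiringAction G S] [MulSemiringAction G K] [SMulDistribClass G S K]
    [Algebra.IsInvariant A S G] [SMulCommClass G A S] [SMulCommClass G k K]
    (hAS : Function.Injective (algebraMap A S)) :
    Nonempty (FractionRing A ≃ₐ[k] FixedPoints.intermediateField (F := k) (E := K) G) := by
  have hAK : Function.Injective (IsScalarTower.toAlgHom k A K) := by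
    rw [IsScalarTower.coe_toAlgHom', IsScalarTower.algebraMap_eq A S K]
    exact (IsFractionRing.injective S K).comp hAS
  let f : FractionRing A →ₐ[k] K := IsFractionRing.liftAlgHom hAK
  let _ : Algebra (FractionRing A) K := f.toRingHom.toAlgebra
  have : IsScalarTower A (FractionRing A) K := .of_algebraMap_eq fun a ↦
    (IsFractionRing.lift_algebraMap (K := FractionRing A) hAK a).symm
  have := IsFractionRing.isInvariant G A S (FractionRing A) K
  have hrange : f.fieldRange = FixedPoints.intermediateField (F := k) (E := K) G := by
    ext x
    constructor
    · rintro ⟨y, rfl⟩ g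
      have : SMulCommClass G (FractionRing A) K := IsFractionRing.smulCommClass G A S _ K
      exact smul_algebraMap g y
    · exact fun hx ↦ Algebra.IsInvariant.isInvariant (A := FractionRing A) (G := G) x hx
  exact ⟨(AlgEquiv.ofInjectiveField f).trans (IntermediateField.equivOfEq hrange)⟩

/-- The function field of a representation, its generators and the group action. -/
lemma Representation.exists_functionField (ρ : Representation k G V) (hρ : Function.Injective ρ) :
    ∃ (K : Type u) (_ : Field K) (_ : Algebra k K) (_ : MulSemiringAction G K)
      (_ : FaithfulSMul G K) (_ : SMulCommClass G k K) (d : ℕ) (y : Fin d → K),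
      AlgebraicIndependent k y ∧ IntermediateField.adjoin k (Set.range y) = ⊤ ∧
      (∀ (g : G) i, g • y i ∈ Submodule.span k (insert 1 (Set.range y))) ∧
      Nonempty (FractionRing ρ.invariantRing ≃ₐ[k]
        FixedPoints.intermediateField (F := k) (E := K) G) := by
  let S := SymmetricAlgebra k (Module.Dual k V)
  let K := FractionRing S
  let _ := ρ.coordinateAction
  let _ : MulSemiringAction G K := IsFractionRing.mulSemiringAction G S K
  have hgS (g : G) (f : S) : g • algebraMap S K f = algebraMap S K (ρ.coordinateMap g f) := by
    rw [Algebra.algebraMap_eq_smul_one, smul_distrib_smul, smul_one]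
    exact (Algebra.algebraMap_eq_smul_one _).symm
  have hgk : SMulCommClass G k K := ⟨fun g a x ↦ by
    rw [Algebra.smul_def, Algebra.smul_def, smul_mul', IsScalarTower.algebraMap_apply k S K, hgS,
      AlgHom.commutes]⟩
  let b := Module.finBasis k (Module.Dual k V)
  let y := fun i ↦ algebraMap S K (SymmetricAlgebra.ι k _ (b i))
  obtain ⟨hy, hy'⟩ : AlgebraicIndependent k y ∧
      IntermediateField.adjoin k (Set.range y) = ⊤ := by
    simpa [y] using IsFractionRing.generators_of_equiv (K := K)
      (SymmetricAlgebra.equivMvPolynomial b).symm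
  let j : Module.Dual k V →ₗ[k] K :=
    (IsScalarTower.toAlgHom k S K).toLinearMap ∘ₗ SymmetricAlgebra.ι k _
  have hgj (g : G) (φ : Module.Dual k V) : g • j φ = j (ρ.dual g φ) := by
    refine (hgS g _).trans (congrArg _ (ρ.coordinateMap_ι g φ))
  have hj : Function.Injective j := by
    have hli : LinearIndependent k (j ∘ b) := hy.linearIndependent
    refine (injective_iff_map_eq_zero j).2 fun φ hφ ↦ ?_
    rw [← b.sum_repr φ, map_sum] at hφ
    simp_rw [map_smul] at hφ
    exact b.ext_elem fun i ↦ by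
      rw [Fintype.linearIndependent_iff.1 hli _ hφ i, map_zero, Finsupp.zero_apply]
  have hf : FaithfulSMul G K := ⟨fun {g h} hgh ↦ by
    rw [← inv_mul_eq_one]
    have hfix (φ : Module.Dual k V) : ρ.dual (g⁻¹ * h) φ = φ := hj (by
      rw [← hgj, mul_smul, ← hgh, inv_smul_smul])
    -- The dual action precomposes with the inverse, so it is the inverse that is seen to act
    -- trivially on `V`, as linear forms separate vectors.
    refine inv_eq_one.1 (hρ (LinearMap.ext fun v ↦ ?_))
    rw [map_one]
    refine sub_eq_zero.1 ((Module.forall_dual_apply_eq_zero_iff k _).1 fun φ ↦ ?_)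
    rw [map_sub, sub_eq_zero]
    exact DFunLike.congr_fun (hfix φ) v⟩
  refine ⟨K, inferInstance, inferInstance, inferInstance, hf, hgk, _, y, hy, hy', fun g i ↦ ?_, ?_⟩
  · have : LinearMap.range j ≤ Submodule.span k (insert 1 (Set.range y)) := by
      rw [LinearMap.range_eq_map, ← b.span_eq, Submodule.map_span, Submodule.span_le]
      rintro _ ⟨_, ⟨i, rfl⟩, rfl⟩
      exact Submodule.subset_span (.inr ⟨i, rfl⟩)
    exact this ⟨_, (hgj g (b i)).symm⟩
  · have := ρ.isInvariant_invariantRing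
    have : SMulCommClass G ρ.invariantRing S := ρ.smulCommClass_invariantRing
    exact nonempty_fractionRing_algEquiv_fixed k ρ.invariantRing S K G Subtype.val_injective

end

theorem mainTheorem9 {k : Type u} [Field k] [IsAlgClosed k]
    (ℓ : ℕ) [Fact ℓ.Prime] (n : ℕ) (G : Sylow ℓ (Equiv.Perm (Fin n)))
    {V : Type u} [AddCommGroup V] [Module k V] [FiniteDimensional k V]
    (ρ : Representation k G V) (hρ : Function.Injective ρ) :
    Scheme.IsStablyRationalOver ρ.quotientVarietyHom := by
  obtain ⟨K, _, _, _, _, _, d, y, hy, hy', hG, ⟨e⟩⟩ := ρ.exists_functionField hρ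
  have h := (G.isStablyRationalField_fixed k ℓ n K hy hy' hG).of_algEquiv e
  have := ρ.finiteType_invariantRing
  exact isStablyRationalOver_Spec (A := ρ.invariantRing) h
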